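/- Let $\mathbf{Meas}$ be the category of measurable spaces and measurable functions. Let $(G,\eta^G,\mu^G)$ be the Giry monad on $\mathbf{Meas}$: $GX$ is the set of probability measures on $X$, with the $\sigma$-algebra generated by the evaluations $\nu\mapsto\nu(U)$ ($U\subseteq X$ measurable); $Gf$ is push-forward along $f$; $\eta^G_X(x)=\delta_x$; and $\mu^G_X(\theta)(U)=\int_{GX}\nu(U)\,d\theta(\nu)$. Let $(B,\eta^B,\mu^B)$ be the bag monad on $\mathbf{Meas}$: $BX$ is the set of finite bags (multisets) of elements of $X$, with the $\sigma$-algebra generated by the sets $A^U_k=\{b\in BX : b \text{ contains exactly } k \text{ elements in } U, \text{ counted with multiplicity}\}$ ($U\subseteq X$ measurable, $k\in\mathbb N$); $Bf$ applies $f$ elementwise; $\eta^B_X(x)=[x]$; and $\mu^B_X([b_1,\dots,b_n])$ is the union of $b_1,\dots,b_n$ with multiplicities added. For $n\in\mathbb N$ let $K_n:X^n\to BX$, $(x_1,\dots,x_n)\mapsto[x_1,\dots,x_n]$. **Theorem.** The rule $$l_X([\nu_1,\dots,\nu_n]) = (\nu_1\otimes\cdots\otimes\nu_n)\circ K_n^{-1}\qquad(n\ge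 0,\ \nu_1,\dots,\nu_n\in GX)$$ gives a well-defined measurable map $l_X:BGX\to GBX$ for every measurable space $X$, and these maps form a natural transformation $l:BG\to GB$. It is a distributive law of $G$ over $B$, that is, $$l\circ B\eta^G=\eta^G B,\qquad G\eta^B=l\circ\eta^B G,$$ $$l\circ B\mu^G=\mu^G B\circ Gl\circ lG,\qquad G\mu^B\circ lB\circ Bl=l\circ\mu^B G.$$ Consequently the composite functor $GB$ (where $GBX$ is the space of point processes on $X$, i.e. probability measures on bags) is a monad on $\mathbf{Meas}$ with unit and multiplication $$\eta^{GB}=\eta^G*\eta^B:1\to GB,\qquad \mu^{GB}:GBGB\xrightarrow{\,GlB\,}GGBB\xrightarrow{\,\mu^G*\mu^B\,}GB,$$ where $*$ denotes horizontal composition of natural transformations. -/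

import Mathlib

open CategoryTheory MeasureTheory

universe v u

/-! ### Monads and distributive laws on an arbitrary category -/

section Distributive

variable {C : Type u} [Category.{v} C]

/-- The monad laws for an endofunctor `F` with given unit `η` and multiplication `μ`. -/
structure IsMonad (F : C ⥤ C) (η : 𝟭 C ⟶ F) (μ : F ⋙ F ⟶ F) : Prop where
  assoc : ∀ X, F.map (μ.app X) ≫ μ.app X = μ.app (F.obj X) ≫ μ.app X
  left_unit : ∀ X, η.app (F.obj X) ≫ μ.app X = 𝟙 (F.obj X)
  right_unit : ∀ X, F.map (η.app X) ≫ μ.app X = 𝟙 (F.obj X)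

/-- `IsMonad F η μ` says exactly that `(F, η, μ)` is a monad in the sense of Mathlib. -/
def IsMonad.toMonad {F : C ⥤ C} {η : 𝟭 C ⟶ F} {μ : F ⋙ F ⟶ F} (h : IsMonad F η μ) : Monad C where
  toFunctor := F
  η := η
  μ := μ
  assoc := h.assoc
  left_unit := h.left_unit
  right_unit := h.right_unit

/-- A natural transformation `l : ST → TS` (`S` after `T` to `T` after `S`) is a distributive law
of the monad `T` over the monad `S`. In Mathlib `T ⋙ S` means "first `T`, then `S`", and `f ≫ g`
means "first `f`, then `g`". -/
structure IsDistributiveLaw (T S : Monad C)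
    (l : T.toFunctor ⋙ S.toFunctor ⟶ S.toFunctor ⋙ T.toFunctor) : Prop where
  /-- `l ∘ Sη^T = η^T S` -/
  triangle_one : ∀ X : C,
    S.map (T.η.app X) ≫ l.app X = T.η.app (S.obj X)
  /-- `Tη^S = l ∘ η^S T` -/
  triangle_two : ∀ X : C,
    T.map (S.η.app X) = S.η.app (T.obj X) ≫ l.app X
  /-- `l ∘ Sμ^T = μ^T S ∘ Tl ∘ lT` -/
  pentagon_one : ∀ X : C,
    S.map (T.μ.app X) ≫ l.app X = l.app (T.obj X) ≫ T.map (l.app X) ≫ T.μ.app (S.obj X)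
  /-- `Tμ^S ∘ lS ∘ Sl = l ∘ μ^S T` -/
  pentagon_two : ∀ X : C,
    S.map (l.app X) ≫ l.app (S.obj X) ≫ T.map (S.μ.app X) = S.μ.app (T.obj X) ≫ l.app X

/-- The unit of the composite: the horizontal composition `η^T ∗ η^S : 1 → TS`. -/
def compositeUnit (T S : Monad C) : 𝟭 C ⟶ S.toFunctor ⋙ T.toFunctor :=
  S.η ◫ T.η

/-- The multiplication of the composite: `TSTS → TTSS → TS`, namely `TlS` followed by the
horizontal composition `μ^T ∗ μ^S`. -/
def compositeMul (T S : Monad C) (l : T.toFunctor ⋙ S.toFunctor ⟶ S.toFunctor ⋙ T.toFunctor) :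
    (S.toFunctor ⋙ T.toFunctor) ⋙ (S.toFunctor ⋙ T.toFunctor) ⟶ S.toFunctor ⋙ T.toFunctor where
  app X := T.map (l.app (S.obj X)) ≫ (S.μ ◫ T.μ).app X
  naturality X Y f := by
    have h1 := l.naturality (S.map f)
    have h2 := (S.μ ◫ T.μ).naturality f
    simp only [Functor.comp_map] at h1 h2 ⊢
    rw [← Category.assoc, ← T.map_comp, h1, T.map_comp, Category.assoc, h2, Category.assoc]

end Distributive

/-! ### The Giry monad of probability measures on `MeasCat` -/

section Giry

noncomputable section

variable {X Y : Type u} [MeasurableSpace X] [MeasurableSpace Y]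

theorem measurable_probMap {f : X → Y} (hf : Measurable f) :
    Measurable fun ν : ProbabilityMeasure X => ν.map hf.aemeasurable :=
  ((Measure.measurable_map f hf).comp measurable_subtype_coe).subtype_mk

/-- The Dirac probability measure. -/
def probDirac (x : X) : ProbabilityMeasure X := ⟨Measure.dirac x, inferInstance⟩

theorem measurable_probDirac : Measurable (probDirac : X → ProbabilityMeasure X) :=
  Measure.measurable_dirac.subtype_mk

/-- The average `U ↦ ∫ ρ(U) dν(ρ)` of a probability measure `ν` on probability measures. -/
def probJoin (ν : ProbabilityMeasure (ProbabilityMeasure X)) : ProbabilityMeasure X :=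
  ⟨Measure.bind (ν : Measure (ProbabilityMeasure X)) fun ρ => (ρ : Measure X), by
    constructor
    refine (Measure.bind_apply MeasurableSet.univ measurable_subtype_coe.aemeasurable).trans ?_
    refine (lintegral_congr (g := fun _ => 1) fun ρ => ρ.2.measure_univ).trans ?_
    exact lintegral_one.trans ν.2.measure_univ⟩

theorem probJoin_apply (ν : ProbabilityMeasure (ProbabilityMeasure X)) {U : Set X}
    (hU : MeasurableSet U) :
    (probJoin ν : Measure X) U =
      ∫⁻ ρ : ProbabilityMeasure X, (ρ : Measure X) U ∂(ν : Measure (ProbabilityMeasure X)) :=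
  Measure.bind_apply hU measurable_subtype_coe.aemeasurable

theorem measurable_probJoin :
    Measurable (probJoin : ProbabilityMeasure (ProbabilityMeasure X) → ProbabilityMeasure X) :=
  ((Measure.measurable_bind' measurable_subtype_coe).comp measurable_subtype_coe).subtype_mk

theorem probMeasure_ext {ν ρ : ProbabilityMeasure X}
    (h : ∀ U, MeasurableSet U → (ν : Measure X) U = (ρ : Measure X) U) : ν = ρ :=
  Subtype.ext (Measure.ext h)

theorem measurable_probEval {U : Set X} (hU : MeasurableSet U) :
    Measurable fun ρ : ProbabilityMeasure X => (ρ : Measure X) U :=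
  (Measure.measurable_coe hU).comp measurable_subtype_coe

theorem lintegral_probJoin (ν : ProbabilityMeasure (ProbabilityMeasure X)) {g : X → ENNReal}
    (hg : Measurable g) :
    ∫⁻ x, g x ∂(probJoin ν : Measure X) =
      ∫⁻ ρ : ProbabilityMeasure X, ∫⁻ x, g x ∂(ρ : Measure X)
        ∂(ν : Measure (ProbabilityMeasure X)) :=
  Measure.lintegral_bind measurable_subtype_coe.aemeasurable hg.aemeasurable

theorem probJoin_map_apply {Z : Type u} [MeasurableSpace Z] (ν : ProbabilityMeasure Z)
    {f : Z → ProbabilityMeasure X} (hf : Measurable f) {U : Set X} (hU : MeasurableSet U) :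
    (probJoin (ν.map hf.aemeasurable) : Measure X) U =
      ∫⁻ z, (f z : Measure X) U ∂(ν : Measure Z) := by
  rw [probJoin_apply _ hU]
  exact lintegral_map (measurable_probEval hU) hf

theorem probJoin_map_map {f : X → Y} (hf : Measurable f)
    (ν : ProbabilityMeasure (ProbabilityMeasure X)) :
    probJoin (ν.map (measurable_probMap hf).aemeasurable) =
      (probJoin ν).map hf.aemeasurable :=
  probMeasure_ext fun U hU => by
    refine (probJoin_map_apply ν (measurable_probMap hf) hU).trans ?_
    refine Eq.trans ?_ (Measure.map_apply hf hU).symm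
    rw [probJoin_apply _ (hf hU)]
    exact lintegral_congr fun ρ => Measure.map_apply hf hU

theorem probJoin_map_probJoin
    (ν : ProbabilityMeasure (ProbabilityMeasure (ProbabilityMeasure X))) :
    probJoin (ν.map measurable_probJoin.aemeasurable) = probJoin (probJoin ν) :=
  probMeasure_ext fun U hU => by
    refine (probJoin_map_apply ν measurable_probJoin hU).trans ?_
    rw [probJoin_apply _ hU, lintegral_probJoin _ (measurable_probEval hU)]
    exact lintegral_congr fun ρ => probJoin_apply ρ hU

theorem probJoin_probDirac (ν : ProbabilityMeasure X) : probJoin (probDirac ν) = ν :=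
  probMeasure_ext fun U hU => by
    rw [probJoin_apply _ hU]
    exact lintegral_dirac' ν (measurable_probEval hU)

theorem probJoin_map_probDirac (ν : ProbabilityMeasure X) :
    probJoin (ν.map measurable_probDirac.aemeasurable) = ν :=
  probMeasure_ext fun U hU => by
    refine (probJoin_map_apply ν measurable_probDirac hU).trans ?_
    rw [← lintegral_indicator_one hU]
    exact lintegral_congr fun x => Measure.dirac_apply' x hU

/-- The Giry functor: probability measures with the σ-algebra generated by the evaluations,
acting on maps by push-forward. -/
def giryFunctor : MeasCat.{u} ⥤ MeasCat.{u} where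
  obj X := MeasCat.of (ProbabilityMeasure X)
  map f := ⟨fun ν => ν.map f.2.aemeasurable, measurable_probMap f.2⟩
  map_id _ := Subtype.ext <| funext fun _ => Subtype.ext Measure.map_id
  map_comp f g := Subtype.ext <| funext fun _ => Subtype.ext (Measure.map_map g.2 f.2).symm

/-- The Giry monad of probability measures. -/
def giryMonad : Monad MeasCat.{u} where
  toFunctor := giryFunctor
  η :=
    { app := fun X => ⟨(probDirac : X → ProbabilityMeasure X), measurable_probDirac⟩
      naturality := fun _ _ f => Subtype.ext <| funext fun x =>
        Subtype.ext (Measure.map_dirac' f.2 x).symm }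
  μ :=
    { app := fun X => ⟨(probJoin : ProbabilityMeasure (ProbabilityMeasure X) → _),
        measurable_probJoin⟩
      naturality := fun _ _ f => Subtype.ext <| funext (probJoin_map_map f.2) }
  assoc _ := Subtype.ext <| funext probJoin_map_probJoin
  left_unit _ := Subtype.ext <| funext probJoin_probDirac
  right_unit _ := Subtype.ext <| funext probJoin_map_probDirac

end

end Giry

/-! ### The monad of finite bags on `MeasCat` -/

section Bag

noncomputable section

variable {X Y : Type u}

open Classical in
/-- The number of elements of the bag `b`, counted with multiplicity, that lie in `U`. -/
def bagCount (U : Set X) (b : Multiset X) : ℕ := b.countP (· ∈ U)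

/-- The σ-algebra on bags generated by the sets
`{b | b contains exactly k elements in U}`, `U` measurable, `k` a natural number. -/
instance bagMeasurableSpace [MeasurableSpace X] : MeasurableSpace (Multiset X) :=
  MeasurableSpace.generateFrom
    {A | ∃ (U : Set X) (k : ℕ), MeasurableSet U ∧ A = {b | bagCount U b = k}}

theorem bagCount_zero (U : Set X) : bagCount U 0 = 0 := by simp [bagCount]

theorem bagCount_cons (U : Set X) (x : X) (b : Multiset X) :
    bagCount U (x ::ₘ b) = bagCount U b + U.indicator (fun _ => 1) x := by
  classical
  simp [bagCount, Multiset.countP_cons, Set.indicator_apply]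

theorem bagCount_add (U : Set X) (a b : Multiset X) :
    bagCount U (a + b) = bagCount U a + bagCount U b := by
  simp [bagCount]

theorem bagCount_map (f : X → Y) (U : Set Y) (b : Multiset X) :
    bagCount U (b.map f) = bagCount (f ⁻¹' U) b := by
  induction b using Multiset.induction with
  | empty => simp [bagCount]
  | cons x b ih => simp only [Multiset.map_cons, bagCount_cons, ih]; rfl

theorem measurable_bagCount [MeasurableSpace X] {U : Set X} (hU : MeasurableSet U) :
    Measurable (bagCount U) :=
  measurable_to_countable' fun k => MeasurableSpace.measurableSet_generateFrom ⟨U, k, hU, rfl⟩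

theorem measurable_bag_of_count [MeasurableSpace X] {Z : Type*} [MeasurableSpace Z]
    {f : Z → Multiset X}
    (h : ∀ U, MeasurableSet U → Measurable fun z => bagCount U (f z)) : Measurable f := by
  refine measurable_generateFrom ?_
  rintro _ ⟨U, k, hU, rfl⟩
  exact h U hU (measurableSet_singleton k)

theorem measurable_bagMap [MeasurableSpace X] [MeasurableSpace Y] {f : X → Y}
    (hf : Measurable f) : Measurable (Multiset.map f) :=
  measurable_bag_of_count fun U hU => by
    simpa only [bagCount_map] using measurable_bagCount (hf hU)

theorem measurable_bagSingleton [MeasurableSpace X] :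
    Measurable fun x : X => ({x} : Multiset X) :=
  measurable_bag_of_count fun U hU => by
    have h : (fun x : X => bagCount U {x}) = U.indicator fun _ => 1 := by
      funext x
      rw [← Multiset.cons_zero, bagCount_cons, bagCount_zero, zero_add]
    rw [h]
    exact measurable_const.indicator hU

theorem bagCount_join (U : Set X) (c : Multiset (Multiset X)) :
    (bagCount U c.join : ENNReal) = ∑' j : ℕ, (bagCount {b | j < bagCount U b} c : ENNReal) := by
  induction c using Multiset.induction with
  | empty => simp [bagCount_zero]
  | cons b c ih =>
    simp only [Multiset.join_cons, bagCount_add, bagCount_cons, Nat.cast_add, ENNReal.tsum_add, ih]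
    rw [add_comm]
    congr 1
    rw [tsum_eq_sum (s := Finset.range (bagCount U b))]
    · rw [Finset.sum_congr rfl (g := fun _ => 1)]
      · simp
      · intro j hj
        simp [Finset.mem_range.1 hj]
    · intro j hj
      have : ¬ j < bagCount U b := by simpa using hj
      simp [this]

theorem measurable_bagJoin [MeasurableSpace X] :
    Measurable (Multiset.join : Multiset (Multiset X) → Multiset X) := by
  refine measurable_bag_of_count fun U hU => ?_
  have h : Measurable fun c : Multiset (Multiset X) => (bagCount U c.join : ENNReal) := by
    simp only [bagCount_join]
    refine Measurable.tsum fun j => ?_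
    exact (measurable_of_countable _).comp
      (measurable_bagCount (measurable_bagCount hU measurableSet_Ioi))
  refine measurable_to_countable' fun k => ?_
  have := h (measurableSet_singleton (k : ENNReal))
  convert this using 1
  ext c
  simp

theorem bagJoin_map_join (c : Multiset (Multiset (Multiset X))) :
    (c.map Multiset.join).join = c.join.join := by
  induction c using Multiset.induction with
  | empty => rfl
  | cons b c ih => simp [ih]

theorem bagJoin_map_singleton (b : Multiset X) :
    (b.map fun x => ({x} : Multiset X)).join = b := by
  induction b using Multiset.induction with
  | empty => rfl
  | cons x b ih => simp [ih]

/-- The bag functor: finite multisets, with maps acting elementwise. -/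
def bagFunctor : MeasCat.{u} ⥤ MeasCat.{u} where
  obj X := MeasCat.of (Multiset X)
  map f := ⟨Multiset.map f.1, measurable_bagMap f.2⟩
  map_id _ := Subtype.ext <| funext fun b => Multiset.map_id b
  map_comp f g := Subtype.ext <| funext fun b => (Multiset.map_map g.1 f.1 b).symm

/-- The bag monad: the unit is the singleton bag, the multiplication is the union of bags
with multiplicities. -/
def bagMonad : Monad MeasCat.{u} where
  toFunctor := bagFunctor
  η :=
    { app := fun X => ⟨fun x : X => ({x} : Multiset X), measurable_bagSingleton⟩
      naturality := fun _ _ f => Subtype.ext <| funext fun x =>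
        (Multiset.map_singleton f.1 x).symm }
  μ :=
    { app := fun X => ⟨(Multiset.join : Multiset (Multiset X) → Multiset X), measurable_bagJoin⟩
      naturality := fun _ _ f => Subtype.ext <| funext fun c =>
        (Multiset.map_join f.1 c).symm }
  assoc _ := Subtype.ext <| funext bagJoin_map_join
  left_unit _ := Subtype.ext <| funext fun b => Multiset.singleton_join b
  right_unit _ := Subtype.ext <| funext bagJoin_map_singleton

/-- The map `K_n` sending an `n`-tuple to the bag of its entries. -/
def bagOfTuple {n : ℕ} (x : Fin n → X) : Multiset X := Multiset.ofList (List.ofFn x)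

theorem bagCount_bagOfTuple (U : Set X) {n : ℕ} (x : Fin n → X) :
    bagCount U (bagOfTuple x) = ∑ i, U.indicator (fun _ => 1) (x i) := by
  induction n with
  | zero => simp [bagOfTuple, bagCount_zero]
  | succ n ih =>
    have h : bagOfTuple x = x 0 ::ₘ bagOfTuple fun i => x i.succ := by
      simp [bagOfTuple]
    rw [h, bagCount_cons, ih, Fin.sum_univ_succ, add_comm]

theorem measurable_bagOfTuple [MeasurableSpace X] (n : ℕ) :
    Measurable (bagOfTuple : (Fin n → X) → Multiset X) :=
  measurable_bag_of_count fun U hU => by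
    simp only [bagCount_bagOfTuple]
    exact Finset.measurable_sum _ fun i _ =>
      (measurable_const.indicator hU).comp (measurable_pi_apply i)

/-- The law of the bag `[x_1, …, x_n]` when the `x_i` are sampled independently from `ν_i`: the
push-forward of the product measure along `K_n`. -/
def independentBagLaw [MeasurableSpace X] {n : ℕ} (ν : Fin n → ProbabilityMeasure X) :
    ProbabilityMeasure (Multiset X) :=
  (ProbabilityMeasure.pi ν).map (measurable_bagOfTuple n).aemeasurable

end

end Bag

/-! Bags form a commutative monoid under union, and sampling independently from $\nu_1,\dots,\nu_n$
gives the convolution in this monoid of the laws of the one-element bags $[x_i]$, $x_i\sim\nu_i$.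
Convolution is commutative, so this product depends only on the bag of the $\nu_i$; that is the map
`bagLaw`, and `bagLaw_bagOfTuple` identifies it with the push-forward of the product measure.

The algebraic laws follow by induction on the bag. Push-forward along a monoid homomorphism
(`Multiset.map f`, `Multiset.join`) preserves convolution, which gives naturality and the pentagon
for $\mu^B$. Averaging is bilinear for convolution by Fubini (`bagConv_probJoin`), which gives the
pentagon for $\mu^G$.

The analytic point is measurability, `measurable_bagLaw`. A law on bags is determined by the joint
counts in finitely many measurable sets, encoded in a generating series. Convolution becomes
multiplication of series, so the series of `bagLaw b` is a product over the members of `b` of a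
measurable function. Such a product is a limit of products of simple functions, and these depend
only on finitely many counts of `b`. -/

/-! ### Beck's theorem: a distributive law makes the composite a monad. -/

section Beck

variable {C : Type u} [Category.{v} C]

theorem compositeMul_app (T S : Monad C)
    (l : T.toFunctor ⋙ S.toFunctor ⟶ S.toFunctor ⋙ T.toFunctor) (X : C) :
    (compositeMul T S l).app X = T.map (l.app (S.obj X)) ≫
      T.μ.app (S.obj (S.obj X)) ≫ T.map (S.μ.app X) := rfl

theorem compositeUnit_app (T S : Monad C) (X : C) :
    (compositeUnit T S).app X = S.η.app X ≫ T.η.app (S.obj X) :=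
  (T.η.naturality (S.η.app X)).symm

/-- A distributive law of `T` over `S` makes the composite `TS` a monad. -/
theorem IsDistributiveLaw.isMonad {T S : Monad C}
    {l : T.toFunctor ⋙ S.toFunctor ⟶ S.toFunctor ⋙ T.toFunctor} (h : IsDistributiveLaw T S l) :
    IsMonad (S.toFunctor ⋙ T.toFunctor) (compositeUnit T S) (compositeMul T S l) where
  left_unit X := by
    simp only [compositeMul_app, compositeUnit_app, Functor.comp_obj, Category.assoc]
    have h1 := T.η.naturality (l.app (S.obj X))
    simp only [Functor.id_map, Functor.comp_obj] at h1
    rw [← reassoc_of% h1, T.left_unit_assoc, ← reassoc_of% (h.triangle_two (S.obj X)),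
      ← T.map_comp, S.left_unit]
    exact T.map_id _
  right_unit X := by
    simp only [compositeMul_app, compositeUnit_app, Functor.comp_obj, Functor.comp_map]
    have h1 : S.map (S.η.app X ≫ T.η.app (S.obj X)) ≫ l.app (S.obj X) =
        S.map (S.η.app X) ≫ T.η.app (S.obj (S.obj X)) := by
      rw [S.map_comp, Category.assoc, h.triangle_one]
    rw [← Category.assoc, ← T.map_comp, h1, T.map_comp, Category.assoc, T.right_unit_assoc,
      ← T.map_comp, S.right_unit]
    exact T.map_id _
  assoc X := by
    have h1 := l.naturality (S.μ.app X)
    have h2 := l.naturality (l.app (S.obj X))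
    have h3 := T.μ.naturality (S.map (S.μ.app X))
    have h4 := T.μ.naturality (S.μ.app (T.obj (S.obj X)) ≫ l.app (S.obj X))
    simp only [Functor.comp_map, Functor.comp_obj] at h1 h2 h3 h4
    -- Moves every `l` to the front: naturality at `μ^S`, the pentagon for `μ^T`, then naturality at
    -- `l` itself.
    have hl : S.map (T.map (l.app (S.obj X)) ≫ T.μ.app (S.obj (S.obj X)) ≫ T.map (S.μ.app X)) ≫
        l.app (S.obj X) = l.app (S.obj (T.obj (S.obj X))) ≫ T.map (S.map (l.app (S.obj X))) ≫
          T.map (l.app (S.obj (S.obj X))) ≫ T.map (T.map (S.map (S.μ.app X))) ≫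
            T.μ.app (S.obj (S.obj X)) := by
      rw [S.map_comp, S.map_comp, Category.assoc, Category.assoc, h1,
        reassoc_of% (h.pentagon_one (S.obj (S.obj X))), reassoc_of% h2, ← h3]
    simp only [compositeMul_app, Functor.comp_obj, Functor.comp_map, Category.assoc]
    have hμ : ∀ {A B : C} (g : A ⟶ B), T.map (T.map (T.map g)) ≫ T.μ.app (T.obj B) ≫ T.μ.app B =
        T.μ.app (T.obj A) ≫ T.μ.app A ≫ T.map g := fun g => by
      have e1 := T.μ.naturality g
      have e2 := T.μ.naturality (T.map g)
      simp only [Functor.comp_map, Functor.comp_obj] at e1 e2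
      rw [reassoc_of% e2, e1]
    -- With the pentagon for `μ^S` on the right, both sides begin with the same three instances of
    -- `l`; what remains is associativity of `μ^T` and `μ^S`.
    rw [← T.map_comp_assoc, hl, ← T.map_comp_assoc (S.μ.app (T.obj (S.obj X))), ← reassoc_of% h4,
      ← h.pentagon_two]
    simp only [Functor.map_comp, Category.assoc]
    have ha := T.assoc (S.obj (S.obj X))
    have hS := congrArg T.map (S.assoc X)
    simp only [Functor.map_comp] at hS
    rw [reassoc_of% ha, reassoc_of% (hμ (S.map (S.μ.app X))), reassoc_of% (hμ (S.μ.app (S.obj X))),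
      hS]

end Beck

/-! ### Convolution of random bags and the algebraic laws of independent sampling. -/

section BagLaw

noncomputable section

variable {X Y : Type u} [MeasurableSpace X] [MeasurableSpace Y]

instance : MeasurableAdd₂ (Multiset X) where
  measurable_add := measurable_bag_of_count fun U hU => by
    simp only [bagCount_add]
    exact ((measurable_bagCount hU).comp measurable_fst).add
      ((measurable_bagCount hU).comp measurable_snd)

/-- The law of the union of two independent random bags. -/
def bagConv (μ ν : ProbabilityMeasure (Multiset X)) : ProbabilityMeasure (Multiset X) :=
  ⟨(μ : Measure (Multiset X)).conv ν, inferInstance⟩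

theorem coe_bagConv (μ ν : ProbabilityMeasure (Multiset X)) :
    (bagConv μ ν : Measure (Multiset X)) = (μ : Measure (Multiset X)).conv ν := rfl

theorem measurable_bagConv :
    Measurable fun p : ProbabilityMeasure (Multiset X) × ProbabilityMeasure (Multiset X) =>
      bagConv p.1 p.2 :=
  ((Measure.measurable_map (fun p : Multiset X × Multiset X => p.1 + p.2) measurable_add).comp
    ProbabilityMeasure.measurable_fun_prod).subtype_mk

theorem bagConv_assoc (μ ν ρ : ProbabilityMeasure (Multiset X)) :
    bagConv (bagConv μ ν) ρ = bagConv μ (bagConv ν ρ) :=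
  Subtype.ext (Measure.conv_assoc _ _ _)

theorem bagConv_comm (μ ν : ProbabilityMeasure (Multiset X)) : bagConv μ ν = bagConv ν μ :=
  Subtype.ext (Measure.conv_comm _ _)

theorem bagConv_left_comm (μ ν ρ : ProbabilityMeasure (Multiset X)) :
    bagConv μ (bagConv ν ρ) = bagConv ν (bagConv μ ρ) := by
  rw [← bagConv_assoc, bagConv_comm μ, bagConv_assoc]

theorem probDirac_zero_bagConv (μ : ProbabilityMeasure (Multiset X)) :
    bagConv (probDirac 0) μ = μ :=
  Subtype.ext (Measure.dirac_zero_conv _)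

theorem bagConv_probDirac_zero (μ : ProbabilityMeasure (Multiset X)) :
    bagConv μ (probDirac 0) = μ :=
  Subtype.ext (Measure.conv_dirac_zero _)

theorem bagConv_probDirac_probDirac (a b : Multiset X) :
    bagConv (probDirac a) (probDirac b) = probDirac (a + b) :=
  Subtype.ext (Measure.dirac_conv_dirac a b)

theorem map_bagConv (f : Multiset X →+ Multiset Y) (hf : Measurable f)
    (μ ν : ProbabilityMeasure (Multiset X)) :
    (bagConv μ ν).map hf.aemeasurable = bagConv (μ.map hf.aemeasurable) (ν.map hf.aemeasurable) :=
  Subtype.ext (Measure.map_conv_addMonoidHom f hf)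

theorem map_probDirac {f : X → Y} (hf : Measurable f) (x : X) :
    (probDirac x).map hf.aemeasurable = probDirac (f x) :=
  Subtype.ext (Measure.map_dirac' hf x)

theorem map_map_prob {Z : Type*} [MeasurableSpace Z] {f : X → Y} {g : Y → Z} (hf : Measurable f)
    (hg : Measurable g) (ν : ProbabilityMeasure X) :
    (ν.map hf.aemeasurable).map hg.aemeasurable = ν.map (hg.comp hf).aemeasurable :=
  Subtype.ext (Measure.map_map hg hf)

/-- The law of the one-element bag `[x]` for `x` sampled from `ν`. -/
def singletonLaw (ν : ProbabilityMeasure X) : ProbabilityMeasure (Multiset X) :=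
  ν.map measurable_bagSingleton.aemeasurable

theorem measurable_singletonLaw :
    Measurable (singletonLaw : ProbabilityMeasure X → ProbabilityMeasure (Multiset X)) :=
  measurable_probMap measurable_bagSingleton

/-- This is the well-definedness of the rule on bags: the fold ignores the order of the members. -/
instance : LeftCommutative fun (ν : ProbabilityMeasure X) (μ : ProbabilityMeasure (Multiset X)) =>
    bagConv (singletonLaw ν) μ where
  left_comm _ _ _ := bagConv_left_comm _ _ _

/-- The law of a bag of independent samples, one from each member of a bag of probability
measures. -/
def bagLaw (b : Multiset (ProbabilityMeasure X)) : ProbabilityMeasure (Multiset X) :=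
  b.foldr (fun ν μ => bagConv (singletonLaw ν) μ) (probDirac 0)

theorem bagLaw_zero : bagLaw (0 : Multiset (ProbabilityMeasure X)) = probDirac 0 := rfl

theorem bagLaw_cons (ν : ProbabilityMeasure X) (b : Multiset (ProbabilityMeasure X)) :
    bagLaw (ν ::ₘ b) = bagConv (singletonLaw ν) (bagLaw b) :=
  Multiset.foldr_cons ..

theorem bagLaw_singleton (ν : ProbabilityMeasure X) : bagLaw {ν} = singletonLaw ν :=
  (bagLaw_cons ν 0).trans (bagConv_probDirac_zero _)

theorem bagLaw_add (a b : Multiset (ProbabilityMeasure X)) :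
    bagLaw (a + b) = bagConv (bagLaw a) (bagLaw b) := by
  induction a using Multiset.induction with
  | empty => rw [zero_add, bagLaw_zero, probDirac_zero_bagConv]
  | cons ν a ih => rw [Multiset.cons_add, bagLaw_cons, ih, bagLaw_cons, bagConv_assoc]

theorem singletonLaw_map {f : X → Y} (hf : Measurable f) (ν : ProbabilityMeasure X) :
    singletonLaw (ν.map hf.aemeasurable) =
      (singletonLaw ν).map (measurable_bagMap hf).aemeasurable := by
  exact (map_map_prob hf measurable_bagSingleton ν).trans
    (map_map_prob measurable_bagSingleton (measurable_bagMap hf) ν).symm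

theorem bagLaw_map {f : X → Y} (hf : Measurable f) (b : Multiset (ProbabilityMeasure X)) :
    bagLaw (b.map fun ν => ν.map hf.aemeasurable) =
      (bagLaw b).map (measurable_bagMap hf).aemeasurable := by
  induction b using Multiset.induction with
  | empty => rw [Multiset.map_zero, bagLaw_zero, bagLaw_zero,
      map_probDirac (measurable_bagMap hf), Multiset.map_zero]
  | cons ν b ih =>
    rw [Multiset.map_cons, bagLaw_cons, ih, bagLaw_cons, singletonLaw_map hf]
    exact (map_bagConv (Multiset.mapAddMonoidHom f) (measurable_bagMap hf) _ _).symm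

theorem bagLaw_map_probDirac (b : Multiset X) : bagLaw (b.map probDirac) = probDirac b := by
  induction b using Multiset.induction with
  | empty => rfl
  | cons x b ih =>
    rw [Multiset.map_cons, bagLaw_cons, ih, singletonLaw, map_probDirac measurable_bagSingleton,
      bagConv_probDirac_probDirac, Multiset.singleton_add]

/-- Since `Multiset.join` is additive, it can be applied to each convolution factor, and on
one-element bags of bags it undoes the singleton map. -/
theorem map_join_bagLaw_map_bagLaw (c : Multiset (Multiset (ProbabilityMeasure X))) :
    (bagLaw (c.map bagLaw)).map measurable_bagJoin.aemeasurable = bagLaw c.join := by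
  induction c using Multiset.induction with
  | empty => rw [Multiset.map_zero, bagLaw_zero, map_probDirac measurable_bagJoin]; rfl
  | cons b c ih =>
    rw [Multiset.map_cons, bagLaw_cons, Multiset.join_cons, bagLaw_add, ← ih]
    refine (map_bagConv ⟨⟨Multiset.join, Multiset.join_zero⟩, Multiset.join_add⟩
      measurable_bagJoin _ _).trans ?_
    congr 1
    refine (map_map_prob measurable_bagSingleton measurable_bagJoin _).trans ?_
    exact Subtype.ext ((congrArg (fun f => Measure.map f _)
      (funext Multiset.singleton_join)).trans Measure.map_id)

end

end BagLaw

/-! ### Measurability of independent sampling, via generating series. -/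

section BagMeasurability

noncomputable section

open scoped NNReal MvPowerSeries.WithPiTopology

variable {X : Type u}

/-- The vector of the numbers of elements of a bag in the sets of a finite family. -/
def countVec (s : Finset (Set X)) (b : Multiset X) : s →₀ ℕ :=
  Finsupp.equivFunOnFinite.symm fun U => bagCount U.1 b

theorem countVec_eq_iff (s : Finset (Set X)) (b : Multiset X) (k : s →₀ ℕ) :
    countVec s b = k ↔ ∀ U : s, bagCount U.1 b = k U :=
  DFunLike.ext_iff

theorem countVec_zero (s : Finset (Set X)) : countVec s (0 : Multiset X) = 0 :=
  Finsupp.ext fun U => bagCount_zero U.1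

theorem countVec_add (s : Finset (Set X)) (a b : Multiset X) :
    countVec s (a + b) = countVec s a + countVec s b :=
  Finsupp.ext fun U => bagCount_add U.1 a b

variable [MeasurableSpace X]

/-- Grouping equal factors shows that the product depends on the bag only through finitely many
counts. -/
theorem multiset_prod_map_simpleFunc {M : Type*} [CommMonoid M] (f : SimpleFunc X M)
    (b : Multiset X) :
    (b.map f).prod = ∏ m ∈ f.range, m ^ bagCount (f ⁻¹' {m}) b := by
  classical
  induction b using Multiset.induction with
  | empty => simp [bagCount_zero]
  | cons x b ih =>
    rw [Multiset.map_cons, Multiset.prod_cons, ih]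
    simp only [bagCount_cons, pow_add, Finset.prod_mul_distrib]
    rw [mul_comm]
    congr 1
    -- Adding `x` raises only the exponent of the value `f x`.
    rw [Finset.prod_eq_single (f x)] <;> simp +contextual [eq_comm]

/-- Multiplicative functionals of a bag are measurable. -/
theorem MeasureTheory.StronglyMeasurable.multiset_prod_map {M : Type*} [CommMonoid M]
    [TopologicalSpace M] [TopologicalSpace.PseudoMetrizableSpace M] [ContinuousMul M] {f : X → M}
    (hf : StronglyMeasurable f) : StronglyMeasurable fun b : Multiset X => (b.map f).prod := by
  -- For a fixed bag the product has finitely many factors, so continuity of multiplication carries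
  -- pointwise convergence of the simple approximations to the products.
  refine stronglyMeasurable_of_tendsto Filter.atTop
    (f := fun n b => (b.map (hf.approx n)).prod) (fun n => ?_) (tendsto_pi_nhds.2 fun b =>
      tendsto_multiset_prod b fun x _ => hf.tendsto_approx x)
  simp only [multiset_prod_map_simpleFunc]
  refine Finset.stronglyMeasurable_fun_prod _ fun m _ => ?_
  exact (StronglyMeasurable.of_discrete (f := fun k : ℕ => m ^ k)).comp_measurable
    (measurable_bagCount ((hf.approx n).measurableSet_preimage _))

theorem measurableSet_countVec {s : Finset (Set X)} (hs : ∀ U ∈ s, MeasurableSet U)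
    (k : s →₀ ℕ) : MeasurableSet {b : Multiset X | countVec s b = k} := by
  simp only [countVec_eq_iff, Set.ofPred_forall]
  exact MeasurableSet.iInter fun U =>
    measurable_bagCount (hs U.1 U.2) (measurableSet_singleton (k U))

/-- The sets prescribing the numbers of elements in finitely many measurable sets. -/
def countCylinders (X : Type u) [MeasurableSpace X] : Set (Set (Multiset X)) :=
  {A | ∃ (s : Finset (Set X)) (k : s →₀ ℕ),
    (∀ U ∈ s, MeasurableSet U) ∧ A = {b | countVec s b = k}}

/-- Joint counts are used because the generating sets, each fixing a single count, need not be
closed under intersection. -/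
theorem isPiSystem_countCylinders : IsPiSystem (countCylinders X) := by
  classical
  rintro _ ⟨s, k, hs, rfl⟩ _ ⟨t, j, ht, rfl⟩ ⟨b, hb, hb'⟩
  -- The common point `b` supplies the count vector on `s ∪ t`, so `k` and `j` need not be glued by
  -- hand.
  refine ⟨s ∪ t, countVec (s ∪ t) b, fun U hU => (Finset.mem_union.1 hU).elim (hs U) (ht U), ?_⟩
  obtain rfl : countVec s b = k := hb
  obtain rfl : countVec t b = j := hb'
  ext a
  simp only [Set.mem_inter_iff, Set.mem_ofPred_eq, countVec_eq_iff]
  refine ⟨fun h U => (Finset.mem_union.1 U.2).elim (fun hU => h.1 ⟨U, hU⟩) fun hU => h.2 ⟨U, hU⟩,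
    fun h => ⟨fun U => h ⟨U, Finset.mem_union_left _ U.2⟩,
      fun U => h ⟨U, Finset.mem_union_right _ U.2⟩⟩⟩

theorem generateFrom_countCylinders :
    MeasurableSpace.generateFrom (countCylinders X) = bagMeasurableSpace := by
  refine le_antisymm (MeasurableSpace.generateFrom_le ?_) (MeasurableSpace.generateFrom_le ?_)
  · rintro _ ⟨s, k, hs, rfl⟩
    exact measurableSet_countVec hs k
  · rintro _ ⟨U, k, hU, rfl⟩
    refine MeasurableSpace.measurableSet_generateFrom
      ⟨{U}, Finsupp.equivFunOnFinite.symm fun _ => k, by simpa using hU, ?_⟩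
    ext b
    simp [countVec_eq_iff]

/-- The generating series of the numbers of elements of a random bag in a finite family of sets. -/
def countSeries (s : Finset (Set X)) (μ : ProbabilityMeasure (Multiset X)) : MvPowerSeries s ℝ≥0 :=
  fun k => μ {b | countVec s b = k}

theorem coe_coeff_countSeries (s : Finset (Set X)) (μ : ProbabilityMeasure (Multiset X))
    (k : s →₀ ℕ) : ((MvPowerSeries.coeff k (countSeries s μ) : ℝ≥0) : ENNReal) =
      (μ : Measure (Multiset X)) {b | countVec s b = k} :=
  ProbabilityMeasure.ennreal_coeFn_eq_coeFn_toMeasure _ _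

theorem countSeries_probDirac_zero {s : Finset (Set X)} (hs : ∀ U ∈ s, MeasurableSet U) :
    countSeries s (probDirac (0 : Multiset X)) = 1 := by
  classical
  refine MvPowerSeries.ext fun k => ENNReal.coe_injective ?_
  rw [coe_coeff_countSeries, MvPowerSeries.coeff_one]
  refine (Measure.dirac_apply' _ (measurableSet_countVec hs k)).trans ?_
  simp only [Set.indicator_apply, Set.mem_ofPred_eq, countVec_zero, eq_comm (a := k)]
  split_ifs <;> simp

/-- Counts add under union, so the joint counts of an independent union are distributed by the
Cauchy product. -/
theorem countSeries_bagConv {s : Finset (Set X)} (hs : ∀ U ∈ s, MeasurableSet U)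
    (μ ν : ProbabilityMeasure (Multiset X)) :
    countSeries s (bagConv μ ν) = countSeries s μ * countSeries s ν := by
  classical
  refine MvPowerSeries.ext fun k => ENNReal.coe_injective ?_
  have hadd : Measurable fun p : Multiset X × Multiset X => p.1 + p.2 := measurable_add
  have hU : (fun p : Multiset X × Multiset X => p.1 + p.2) ⁻¹' {b | countVec s b = k} =
      ⋃ p ∈ Finset.HasAntidiagonal.antidiagonal k,
        {b | countVec s b = p.1} ×ˢ {b | countVec s b = p.2} := by
    ext p
    simp [countVec_add]
  rw [coe_coeff_countSeries, MvPowerSeries.coeff_mul]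
  push_cast
  simp only [coe_coeff_countSeries]
  refine (Measure.map_apply hadd (measurableSet_countVec hs k)).trans ?_
  rw [hU, measure_biUnion_finset]
  · exact Finset.sum_congr rfl fun p _ => Measure.prod_prod _ _
  · intro p _ q _ hpq
    refine Set.disjoint_left.2 fun z hz hz' => hpq ?_
    exact Prod.ext (hz.1.symm.trans hz'.1) (hz.2.symm.trans hz'.2)
  · exact fun p _ => (measurableSet_countVec hs _).prod (measurableSet_countVec hs _)

theorem countSeries_bagLaw {s : Finset (Set X)} (hs : ∀ U ∈ s, MeasurableSet U)
    (b : Multiset (ProbabilityMeasure X)) :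
    countSeries s (bagLaw b) = (b.map fun ν => countSeries s (singletonLaw ν)).prod := by
  induction b using Multiset.induction with
  | empty => exact countSeries_probDirac_zero hs
  | cons ν b ih =>
    rw [bagLaw_cons, countSeries_bagConv hs, ih, Multiset.map_cons, Multiset.prod_cons]

/-- There are countably many exponents, so the series form a countable product of copies of `ℝ≥0`,
where measurability gives strong measurability. Coefficients in `ℝ≥0` also keep multiplication
continuous, which fails in `ENNReal`. -/
theorem stronglyMeasurable_countSeries {s : Finset (Set X)} (hs : ∀ U ∈ s, MeasurableSet U) :
    StronglyMeasurable
      (countSeries s : ProbabilityMeasure (Multiset X) → MvPowerSeries s ℝ≥0) := by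
  have h : Measurable fun (μ : ProbabilityMeasure (Multiset X)) (k : s →₀ ℕ) =>
      μ {b | countVec s b = k} :=
    measurable_pi_lambda _ fun k =>
      (measurable_probEval (measurableSet_countVec hs k)).ennreal_toNNReal
  exact h.stronglyMeasurable

theorem measurable_bagLaw :
    Measurable (bagLaw : Multiset (ProbabilityMeasure X) → ProbabilityMeasure (Multiset X)) := by
  -- For a family of probability measures it suffices to test measurability on a generating
  -- π-system.
  refine Measurable.subtype_mk (Measurable.measure_of_isPiSystem_of_isProbabilityMeasure
    (μ := fun b : Multiset (ProbabilityMeasure X) => (bagLaw b : Measure (Multiset X)))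
    generateFrom_countCylinders.symm isPiSystem_countCylinders ?_)
  rintro _ ⟨s, k, hs, rfl⟩
  have : TopologicalSpace.PseudoMetrizableSpace (MvPowerSeries s ℝ≥0) :=
    inferInstanceAs (TopologicalSpace.PseudoMetrizableSpace ((s →₀ ℕ) → ℝ≥0))
  simp only [← coe_coeff_countSeries, countSeries_bagLaw hs]
  refine measurable_coe_nnreal_ennreal.comp (Continuous.comp_stronglyMeasurable
    (MvPowerSeries.WithPiTopology.continuous_coeff ℝ≥0 k) ?_).measurable
  exact ((stronglyMeasurable_countSeries hs).comp_measurable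
    measurable_singletonLaw).multiset_prod_map

end

end BagMeasurability

/-! ### Compatibility with averaging, and the product-measure formula. -/

section BagLawAverage

noncomputable section

variable {X Y : Type u} [MeasurableSpace X] [MeasurableSpace Y]

theorem bagConv_apply (μ ν : ProbabilityMeasure (Multiset X)) {A : Set (Multiset X)}
    (hA : MeasurableSet A) : (bagConv μ ν : Measure (Multiset X)) A =
      ∫⁻ a, ∫⁻ b, A.indicator 1 (a + b) ∂(ν : Measure (Multiset X)) ∂(μ : Measure (Multiset X)) := by
  rw [coe_bagConv, ← lintegral_indicator_one hA,
    Measure.lintegral_conv (measurable_one.indicator hA)]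

/-- Averaging is bilinear with respect to convolution. -/
theorem bagConv_probJoin (θ σ : ProbabilityMeasure (ProbabilityMeasure (Multiset X)))
    {A : Set (Multiset X)} (hA : MeasurableSet A) :
    (bagConv (probJoin θ) (probJoin σ) : Measure (Multiset X)) A =
      ∫⁻ μ : ProbabilityMeasure (Multiset X), ∫⁻ ν : ProbabilityMeasure (Multiset X),
        (bagConv μ ν : Measure (Multiset X)) A ∂(σ : Measure (ProbabilityMeasure (Multiset X)))
          ∂(θ : Measure (ProbabilityMeasure (Multiset X))) := by
  have hf : Measurable fun p : Multiset X × Multiset X =>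
      A.indicator (1 : Multiset X → ENNReal) (p.1 + p.2) :=
    (measurable_one.indicator hA).comp measurable_add
  rw [bagConv_apply _ _ hA, lintegral_probJoin]
  · refine lintegral_congr fun μ => ?_
    simp only [bagConv_apply _ _ hA]
    -- The tautological kernel `ν ↦ ν` makes the inner integral jointly measurable in `a` and `ν`,
    -- as Fubini requires for exchanging `μ` and `σ`.
    let κ : ProbabilityTheory.Kernel (ProbabilityMeasure (Multiset X)) (Multiset X) :=
      ⟨fun ν => ν, measurable_subtype_coe⟩
    have : ProbabilityTheory.IsMarkovKernel κ := ⟨fun ν => ν.2⟩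
    refine (lintegral_congr fun a =>
      lintegral_probJoin σ (hf.comp measurable_prodMk_left)).trans ?_
    refine lintegral_lintegral_swap (Measurable.aemeasurable ?_)
    refine Measurable.lintegral_kernel_prod_right' (κ := κ.comap Prod.snd measurable_snd)
      (f := fun p : (Multiset X × ProbabilityMeasure (Multiset X)) × Multiset X =>
        A.indicator (1 : Multiset X → ENNReal) (p.1.1 + p.2)) ?_
    exact hf.comp ((measurable_fst.comp measurable_fst).prodMk measurable_snd)
  · exact hf.lintegral_prod_right'

/-- In the induction step both sides become the double integral of `bagConv (singletonLaw ν) (bagLaw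
c)` over `ν` drawn from `θ` and `c` drawn from `bagLaw b`. -/
theorem bagLaw_map_probJoin (b : Multiset (ProbabilityMeasure (ProbabilityMeasure X))) :
    bagLaw (b.map probJoin) = probJoin ((bagLaw b).map measurable_bagLaw.aemeasurable) := by
  induction b using Multiset.induction with
  | empty =>
    rw [Multiset.map_zero, bagLaw_zero, bagLaw_zero, map_probDirac measurable_bagLaw,
      probJoin_probDirac, bagLaw_zero]
  | cons θ b ih =>
    refine probMeasure_ext fun A hA => ?_
    rw [Multiset.map_cons, bagLaw_cons, ih, singletonLaw,
      ← probJoin_map_map measurable_bagSingleton]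
    refine (bagConv_probJoin _ _ hA).trans ?_
    rw [probJoin_map_apply _ measurable_bagLaw hA, bagLaw_cons]
    refine Eq.trans ?_
      (Measure.lintegral_conv ((measurable_probEval hA).comp measurable_bagLaw)).symm
    have hA' : Measurable fun
        p : ProbabilityMeasure (Multiset X) × ProbabilityMeasure (Multiset X) =>
          (bagConv p.1 p.2 : Measure (Multiset X)) A := (measurable_probEval hA).comp measurable_bagConv
    refine (lintegral_map ?_ (measurable_probMap measurable_bagSingleton)).trans ?_
    · exact hA'.lintegral_prod_right'
    refine Eq.trans ?_ (lintegral_map ?_ measurable_bagSingleton).symm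
    · refine lintegral_congr fun ν => ?_
      refine (lintegral_map ?_ measurable_bagLaw).trans ?_
      · exact hA'.comp measurable_prodMk_left
      refine lintegral_congr fun c => ?_
      rw [Function.comp_apply, bagLaw_add, bagLaw_singleton]
      rfl
    · exact (((measurable_probEval hA).comp measurable_bagLaw).comp measurable_add).lintegral_prod_right'

/-- Splitting off coordinate `0` writes the product measure as a binary product, matching one step
of the fold; the empty product is the Dirac mass at the empty tuple. -/
theorem bagLaw_bagOfTuple {n : ℕ} (ν : Fin n → ProbabilityMeasure X) :
    bagLaw (bagOfTuple ν) = independentBagLaw ν := by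
  induction n with
  | zero =>
    refine Subtype.ext ?_
    refine Eq.trans ?_ (congrArg (fun μ => Measure.map bagOfTuple μ)
      (Measure.pi_of_empty (fun i => (ν i : Measure X)))).symm
    exact (Measure.map_dirac' (measurable_bagOfTuple 0) _).symm
  | succ n ih =>
    have h : bagOfTuple ν = ν 0 ::ₘ bagOfTuple fun i => ν i.succ := by
      simp [bagOfTuple]
    rw [h, bagLaw_cons, ih]
    refine Subtype.ext ?_
    have he := (measurePreserving_piFinSuccAbove (fun i => (ν i : Measure X)) 0).symm
    have hadd : Measurable fun p : Multiset X × Multiset X => p.1 + p.2 := measurable_add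
    refine (congrArg (Measure.map _) (Measure.map_prod_map _ _ measurable_bagSingleton
      (measurable_bagOfTuple n))).trans ?_
    refine (Measure.map_map hadd
      (measurable_bagSingleton.prodMap (measurable_bagOfTuple n))).trans ?_
    refine Eq.trans ?_ (congrArg (Measure.map bagOfTuple) he.map_eq)
    refine Eq.trans ?_ (Measure.map_map (measurable_bagOfTuple _) he.measurable).symm
    refine congrArg (fun f => Measure.map f _) (funext fun p => ?_)
    simp [bagOfTuple]

end

end BagLawAverage

/-! ### The distributive law and the composite monad. -/

section BagLawTransformation

noncomputable section

/-- Independent sampling as a natural transformation `BG → GB`. -/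
def bagLawTrans : giryMonad.{u}.toFunctor ⋙ bagMonad.{u}.toFunctor ⟶
    bagMonad.{u}.toFunctor ⋙ giryMonad.{u}.toFunctor where
  app X := ⟨(bagLaw : Multiset (ProbabilityMeasure X) → ProbabilityMeasure (Multiset X)),
    measurable_bagLaw⟩
  naturality _ _ f := Subtype.ext <| funext (bagLaw_map f.2)

theorem isDistributiveLaw_bagLawTrans : IsDistributiveLaw giryMonad bagMonad bagLawTrans.{u} where
  triangle_one _ := Subtype.ext <| funext bagLaw_map_probDirac
  triangle_two _ := Subtype.ext <| funext fun ν => (bagLaw_singleton ν).symm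
  pentagon_one X := Subtype.ext <| funext fun b =>
    bagLaw_map_probJoin (X := X) b
  pentagon_two _ := Subtype.ext <| funext map_join_bagLaw_map_bagLaw

end

end BagLawTransformation

theorem mainTheorem1 :
    ∃ l : giryMonad.{u}.toFunctor ⋙ bagMonad.{u}.toFunctor ⟶
        bagMonad.{u}.toFunctor ⋙ giryMonad.{u}.toFunctor,
      (∀ (X : MeasCat.{u}) (n : ℕ) (ν : Fin n → ProbabilityMeasure X),
        (l.app X).1 (bagOfTuple ν) = independentBagLaw ν) ∧
      IsDistributiveLaw giryMonad bagMonad l ∧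
      IsMonad (bagMonad.toFunctor ⋙ giryMonad.toFunctor)
        (compositeUnit giryMonad bagMonad) (compositeMul giryMonad bagMonad l) :=
  ⟨bagLawTrans, fun _ _ ν => bagLaw_bagOfTuple ν, isDistributiveLaw_bagLawTrans,
    isDistributiveLaw_bagLawTrans.isMonad⟩
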